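/- Let $\mathcal N$ be an $n$-input sorting network or permutation network. That is, $\mathcal N$ is a finite acyclic circuit with $n$ inputs and $n$ outputs made of $2$-input $2$-output gates, in which every network input and every gate result feeds exactly one gate operand or network output. It is a sorting network if, with comparators as gates (returning the minimum of the two operands on one result and the maximum on the other), it produces the same output sequence on all $n!$ permutations of $n$ distinct keys. It is a permutation network if, with switches as gates (each either passing or swapping its two operands), for each of the $n!$ permutations $\pi$ some setting of the switches routes every input $i$ to output $\pi(i)$. The DAG of $\mathcal N$ has one node for each of the $n$ inputs and two nodes for each gate, both having as predecessors the two nodes that produce the operands of the gate. Its output nodes are the nodes of out-degree $0$. Consider a BSP with $1\le p\le 2n/e$ processors. An execution is a finite sequence of supersteps; in each, every processor evaluates nodes and sends messages to other processors, each message carrying the value of at most one node and becoming visible at the beginning of the next superstep. A processor can evaluate a node only if the values of all predecessors of the node are in its local memory (evaluated there before, or received in an earlier superstep), and it can send only node values which it holds. The degree of a superstep is the maximum, over all processors, of the number of messages sent and of the number of messages received by the processor in it; the BSP communication complexity $H$ is the sum of the degrees of all supersteps. Let $\mathcal A$ be any such execution that evaluates the DAG of $\mathcal N$ without recomputation, i.e.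 every node (inputs included) is evaluated exactly once, and let $q$ be the maximum number of output nodes evaluated by a processor. Then \[ H_{\mathcal A}\ \ge\ \frac{n\log\bigl(n/(4eq^2)\bigr)}{4p\log(2n/p)}+\frac{\min\{q,\,n-q\}}{4}. \] Moreover, if $q\le n/2$, then \[ H_{\mathcal A}\ >\ \frac{n\log(n/e)}{8p\log(2n/p)}. \] -/

import Mathlib

/-! ### Networks of two-input two-output gates -/

/-- An acyclic circuit with `n` inputs and `n` outputs, whose gates (indexed by `K`) have two
operands and two results each, both indexed by `Bool`. Every consuming port (operand `b` of gate
`k`, written `Sum.inl (k, b)`, or network output `j`, written `Sum.inr j`) is wired to exactly one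
producing port (network input `i`, written `Sum.inl i`, or result `b` of gate `k`, written
`Sum.inr (k, b)`), and every producing port feeds exactly one consuming port. -/
structure GateNetwork (n : ℕ) (K : Type*) where
  wire : (K × Bool) ⊕ Fin n ≃ Fin n ⊕ (K × Bool)
  acyclic : ∀ k : K, ¬ Relation.TransGen
    (fun k₁ k₂ : K => ∃ b₁ b₂ : Bool, wire (Sum.inl (k₂, b₂)) = Sum.inr (k₁, b₁)) k k

namespace GateNetwork

variable {n : ℕ} {K : Type*}

/-- The producing port that feeds operand `b` of gate `k`. -/
def operand (N : GateNetwork n K) (k : K) (b : Bool) : Fin n ⊕ (K × Bool) :=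
  N.wire (Sum.inl (k, b))

/-- The producing port that feeds network output `j`. -/
def out (N : GateNetwork n K) (j : Fin n) : Fin n ⊕ (K × Bool) :=
  N.wire (Sum.inr j)

/-- `val` is the assignment of values to the producing ports when the network runs on the input
sequence `x` and gate `k` with operands `a₀, a₁` returns `op k b a₀ a₁` as its result `b`.
As the network is acyclic, there is exactly one such assignment. -/
def IsRun {α : Type*} (N : GateNetwork n K) (op : K → Bool → α → α → α) (x : Fin n → α)
    (val : Fin n ⊕ (K × Bool) → α) : Prop :=
  (∀ i, val (Sum.inl i) = x i) ∧
  ∀ k b, val (Sum.inr (k, b)) = op k b (val (N.operand k false)) (val (N.operand k true))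

/-- The gate `comparator`: result `false` is the minimum of the operands, result `true` the
maximum. -/
def comparator {α : Type*} [LinearOrder α] (b : Bool) (a₀ a₁ : α) : α :=
  if b then max a₀ a₁ else min a₀ a₁

/-- The gate `switch`: it passes its operands to its results if `swap = false`, and swaps them if
`swap = true`. -/
def switch {α : Type*} (swap : Bool) (b : Bool) (a₀ a₁ : α) : α :=
  if xor swap b then a₁ else a₀

/-- With comparators as gates, the network produces the same output sequence on all `n!`
permutations of `n` distinct input keys. -/
def IsSorting (N : GateNetwork n K) : Prop :=
  ∃ y : Fin n → Fin n, ∀ σ : Equiv.Perm (Fin n), ∃ val : Fin n ⊕ (K × Bool) → Fin n,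
    N.IsRun (fun _ => comparator) σ val ∧ ∀ j, val (N.out j) = y j

/-- With switches as gates, for every permutation `π` some setting of the switches routes every
input `i` to output `π i`. (Each item enters with its label `i`; every port carries exactly one
item, so the routes are disjoint.) -/
def IsPermuting (N : GateNetwork n K) : Prop :=
  ∀ π : Equiv.Perm (Fin n), ∃ (s : K → Bool) (val : Fin n ⊕ (K × Bool) → Fin n),
    N.IsRun (fun k => switch (s k)) id val ∧ ∀ i, val (N.out (π i)) = i

/-- The arcs of the computation DAG of the network. Its nodes are the `n` inputs and a pair of
nodes `(k, false)`, `(k, true)` for every gate `k`, both having the two nodes that produce the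
operands of `k` as predecessors. -/
def Arc (N : GateNetwork n K) (u v : Fin n ⊕ (K × Bool)) : Prop :=
  ∃ (k : K) (b b' : Bool), v = Sum.inr (k, b) ∧ u = N.operand k b'

end GateNetwork

/-! ### Evaluation of a computation DAG on a BSP -/

/-- A message from processor `src` to another processor `dst`. It carries the value of one node of
the DAG, or (`none`) data that are not the value of a node. -/
structure BSPMessage (p : ℕ) (V : Type*) where
  src : Fin p
  dst : Fin p
  ne : src ≠ dst
  content : Option V

/-- The schedule of an execution on a BSP with `p` processors, as far as nodes of a DAG with node
set `V` are concerned: the number of supersteps (numbered `0, …, steps - 1`), the sequence of nodes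
evaluated by processor `i` in superstep `j`, and the messages sent in superstep `j`. The entries
for `j ≥ steps` are meaningless and never used below. -/
structure BSPExecution (p : ℕ) (V : Type*) where
  steps : ℕ
  evals : ℕ → Fin p → List V
  msgs : ℕ → Multiset (BSPMessage p V)

namespace BSPExecution

variable {p : ℕ} {V : Type*}

/-- The nodes whose value is in the local memory of processor `i` at the beginning of superstep
`j`: those that `i` evaluated or received in an earlier superstep. -/
def known (A : BSPExecution p V) (j : ℕ) (i : Fin p) : Set V :=
  {v | ∃ j' < j, v ∈ A.evals j' i ∨ ∃ m ∈ A.msgs j', m.dst = i ∧ m.content = some v}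

/-- In superstep `j`, processor `i` evaluates node `v` as its `k`-th evaluation of this superstep.
The triples `(j, i, k)` with this property are the processor-time pairs of `v`. -/
def EvaluatesAt (A : BSPExecution p V) (v : V) (j : ℕ) (i : Fin p) (k : ℕ) : Prop :=
  j < A.steps ∧ (A.evals j i)[k]? = some v

/-- The execution evaluates the DAG with arc relation `Arc`: every node is evaluated; whenever a
node is evaluated, the values of all its predecessors are in the memory of the evaluating
processor; and a processor sends only node values which it holds. -/
structure Evaluates (A : BSPExecution p V) (Arc : V → V → Prop) : Prop where
  all : ∀ v, ∃ j i k, A.EvaluatesAt v j i k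
  operands : ∀ v j i k, A.EvaluatesAt v j i k →
    ∀ u, Arc u v → u ∈ A.known j i ∨ u ∈ (A.evals j i).take k
  sends : ∀ j < A.steps, ∀ m ∈ A.msgs j, ∀ v, m.content = some v →
    v ∈ A.known j m.src ∨ v ∈ A.evals j m.src

/-- No recomputation: every node is evaluated exactly once. -/
def WithoutRecomputation (A : BSPExecution p V) : Prop :=
  ∀ v, ∃! t : ℕ × Fin p × ℕ, A.EvaluatesAt v t.1 t.2.1 t.2.2

/-- The degree of superstep `j`: the maximum number of messages sent, or received, by any
processor. -/
def degree (A : BSPExecution p V) (j : ℕ) : ℕ :=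
  Finset.univ.sup fun i : Fin p =>
    max ((A.msgs j).countP fun m => m.src = i) ((A.msgs j).countP fun m => m.dst = i)

/-- The BSP communication complexity: the sum of the degrees of the supersteps. -/
def commComplexity (A : BSPExecution p V) : ℕ :=
  ∑ j ∈ Finset.range A.steps, A.degree j

/-- The output nodes (nodes of out-degree `0`) evaluated by processor `i`. -/
def outputsOf (A : BSPExecution p V) (Arc : V → V → Prop) (i : Fin p) : Set V :=
  {v | (∀ w, ¬ Arc v w) ∧ ∃ j k, A.EvaluatesAt v j i k}

/-- The maximum number of output nodes evaluated by a processor. -/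
noncomputable def maxOutputs (A : BSPExecution p V) (Arc : V → V → Prop) : ℕ :=
  Finset.univ.sup fun i : Fin p => (A.outputsOf Arc i).ncard

end BSPExecution

/-! A sorting network is also a permutation network, since a comparator acts as a switch set by its
operands (`IsSorting.isPermuting`). Without recomputation each node `v` has one processor `P v`. For
a permutation `π`, set the switches to realise it and regard each input as a token. The token `i`
starts at `P (Sum.inl i)` and must end at `P (N.out (π i))`; it changes processor only inside a
message that carries a node on its route (`exists_trajectories`). The schedule does not depend on
`π`; only the assignment of tokens to nodes does. Two bounds on the communication `H` follow.

Counting: in one superstep a message moves one token of its source or none, so a superstep of degree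
`h` leads from one placement of tokens to at most `(2n/p)^(p*h)` others. A final placement is shared
by at most `q^n` permutations. Hence `n! ≤ q^n * (2n/p)^(p*H)` (`factorial_le`).

Exchange: for a processor with `q` outputs, some permutation forces `min q (n - q)` tokens to enter
it or to leave it, each in a message of its own (`min_le_commComplexity`).

With `n! ≥ (n/e)^n`, counting is strong for small `q` and exchange for large `q`;
`div_lt_of_counting_of_exchange` balances them. -/

namespace GateNetwork

variable {n : ℕ} {K : Type*}

/-! ### Tokens in networks of switches; sorting networks permute. -/

/-- Gate `k₁` feeds gate `k₂`. -/
def Feeds (N : GateNetwork n K) (k₁ k₂ : K) : Prop :=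
  ∃ b₁ b₂ : Bool, N.wire (Sum.inl (k₂, b₂)) = Sum.inr (k₁, b₁)

theorem wellFounded_feeds [Finite K] (N : GateNetwork n K) : WellFounded N.Feeds := by
  have : IsTrans K (Relation.TransGen N.Feeds) := ⟨fun _ _ _ => Relation.TransGen.trans⟩
  have : Std.Irrefl (Relation.TransGen N.Feeds) := ⟨N.acyclic⟩
  exact Subrelation.wf (fun h => Relation.TransGen.single h)
    (Finite.wellFounded_of_trans_of_irrefl (Relation.TransGen N.Feeds))

/-- Supports induction from the outputs backwards, used to follow a token forwards until it leaves
the network. -/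
theorem wellFounded_flip_feeds [Finite K] (N : GateNetwork n K) :
    WellFounded (flip N.Feeds) := by
  have : IsTrans K (flip (Relation.TransGen N.Feeds)) :=
    ⟨fun _ _ _ h₁ h₂ => Relation.TransGen.trans h₂ h₁⟩
  have : Std.Irrefl (flip (Relation.TransGen N.Feeds)) := ⟨N.acyclic⟩
  exact Subrelation.wf (r := flip (Relation.TransGen N.Feeds))
    (fun h => Relation.TransGen.single (r := N.Feeds) h)
    (Finite.wellFounded_of_trans_of_irrefl _)

/-- A switch forwards each operand to one of its results. -/
theorem exists_switch_eq {α : Type*} (s b : Bool) (a : Bool → α) :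
    ∃ b', switch s b' (a false) (a true) = a b := by
  cases s <;> cases b <;> simp [switch]

/-- Each result of a switch is one of its operands. -/
theorem exists_operand_eq {α : Type*} (s b : Bool) (a : Bool → α) :
    ∃ b', a b' = switch s b (a false) (a true) := by
  cases s <;> cases b <;> simp [switch]

theorem comparator_eq_switch {α : Type*} [LinearOrder α] (b : Bool) (a₀ a₁ : α) :
    comparator b a₀ a₁ = switch (decide (a₁ < a₀)) b a₀ a₁ := by
  rcases lt_or_ge a₁ a₀ with h | h
  · cases b <;> simp [comparator, switch, h, h.le]
  · cases b <;> simp [comparator, switch, h, not_lt.2 h]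

theorem apply_switch {α β : Type*} (f : α → β) (s b : Bool) (a₀ a₁ : α) :
    f (switch s b a₀ a₁) = switch s b (f a₀) (f a₁) := by
  unfold switch; split_ifs <;> rfl

/-- In a network of switches, the value of each port reaches some network output. -/
theorem IsRun.exists_out_eq [Finite K] {α : Type*} {N : GateNetwork n K} {s : K → Bool}
    {x : Fin n → α} {val : Fin n ⊕ (K × Bool) → α}
    (h : N.IsRun (fun k => switch (s k)) x val) (u : Fin n ⊕ (K × Bool)) :
    ∃ j, val (N.out j) = val u := by
  have next : ∀ u, (∃ j, N.out j = u) ∨ ∃ k b, N.operand k b = u := by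
    intro u
    rcases hu : N.wire.symm u with ⟨k, b⟩ | j
    · exact Or.inr ⟨k, b, by rw [operand, ← hu, Equiv.apply_symm_apply]⟩
    · exact Or.inl ⟨j, by rw [out, ← hu, Equiv.apply_symm_apply]⟩
  have gate : ∀ k b, ∃ j, val (N.out j) = val (Sum.inr (k, b)) := by
    intro k
    induction k using N.wellFounded_flip_feeds.induction with
    | _ k ih =>
      intro b
      rcases next (Sum.inr (k, b)) with ⟨j, hj⟩ | ⟨k', b', hk⟩
      · exact ⟨j, by rw [hj]⟩
      · obtain ⟨b'', hb⟩ := exists_switch_eq (s k') b' (fun b => val (N.operand k' b))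
        obtain ⟨j, hj⟩ := ih k' ⟨b, b', hk⟩ b''
        exact ⟨j, by rw [hj, ← hk]; exact (h.2 k' b'').trans hb⟩
  rcases next u with ⟨j, hj⟩ | ⟨k, b, hk⟩
  · exact ⟨j, by rw [hj]⟩
  · obtain ⟨b', hb⟩ := exists_switch_eq (s k) b (fun b => val (N.operand k b))
    obtain ⟨j, hj⟩ := gate k b'
    exact ⟨j, by rw [hj, ← hk]; exact (h.2 k b').trans hb⟩

/-- A sorting network is a permutation network. -/
theorem IsSorting.isPermuting [Finite K] {N : GateNetwork n K} (hN : N.IsSorting) :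
    N.IsPermuting := by
  obtain ⟨y, hy⟩ := hN
  have run : ∀ σ : Equiv.Perm (Fin n), ∃ (s : K → Bool) (val : Fin n ⊕ (K × Bool) → Fin n),
      N.IsRun (fun k => switch (s k)) id val ∧ ∀ j, val (N.out j) = σ.symm (y j) := by
    intro σ
    obtain ⟨val, hval, hout⟩ := hy σ
    -- Each switch imitates its comparator on the keys `σ`; applying `σ.symm` turns a key into the
    -- input it came from.
    refine ⟨fun k => decide (val (N.operand k true) < val (N.operand k false)),
      fun u => σ.symm (val u), ⟨fun i => by simp [hval.1 i], fun k b => ?_⟩,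
      fun j => congrArg σ.symm (hout j)⟩
    simp only [hval.2, comparator_eq_switch]
    exact apply_switch σ.symm _ _ _ _
  -- Switches lose no token, so every key appears in the common output sequence `y`.
  have hsurj : Function.Surjective y := by
    intro i
    obtain ⟨s, val, hval, hout⟩ := run (Equiv.refl _)
    obtain ⟨j, hj⟩ := hval.exists_out_eq (Sum.inl i)
    exact ⟨j, by simpa [hval.1 i, hout] using hj⟩
  intro π
  obtain ⟨s, val, hval, hout⟩ :=
    -- Input `i` receives the key `y (π i)`, which the network delivers to output `π i`.
    run (π.trans (Equiv.ofBijective y ⟨Finite.injective_iff_surjective.2 hsurj, hsurj⟩))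
  exact ⟨s, val, hval, fun i => by rw [hout, Equiv.symm_apply_eq]; rfl⟩

/-- The output nodes of the DAG are the nodes that feed the network outputs. -/
theorem forall_not_arc_iff (N : GateNetwork n K) (u : Fin n ⊕ (K × Bool)) :
    (∀ w, ¬ N.Arc u w) ↔ ∃ j, N.out j = u := by
  constructor
  · intro h
    rcases hu : N.wire.symm u with ⟨k, b⟩ | j
    · exact absurd ⟨k, false, b, rfl, by rw [operand, ← hu, Equiv.apply_symm_apply]⟩
        (h (Sum.inr (k, false)))
    · exact ⟨j, by rw [out, ← hu, Equiv.apply_symm_apply]⟩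
  · rintro ⟨j, rfl⟩ w ⟨k, b, b', -, h⟩
    exact Sum.inr_ne_inl (N.wire.injective h)

theorem out_injective (N : GateNetwork n K) : Function.Injective N.out :=
  N.wire.injective.comp Sum.inr_injective

end GateNetwork

/-! ### Trajectories of tokens over the processors. -/

namespace BSPExecution

variable {p : ℕ} {V : Type*}

/-- In superstep `j`, a token `i` at processor `a` either stays there or travels to `b` with a
message whose content is a node occupied by the token. -/
def Moves {ι : Type*} (A : BSPExecution p V) (val : V → ι) (i : ι) (j : ℕ) (a b : Fin p) : Prop :=
  b = a ∨ ∃ m ∈ A.msgs j, m.src = a ∧ m.dst = b ∧ ∃ u, m.content = some u ∧ val u = i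

/-- Token `i`, which starts at processor `a₀`, can be at processor `a` at the beginning of
superstep `j`. -/
inductive Reaches {ι : Type*} (A : BSPExecution p V) (val : V → ι) (i : ι) (a₀ : Fin p) :
    ℕ → Fin p → Prop
  | start : Reaches A val i a₀ 0 a₀
  | step {j : ℕ} {a b : Fin p} : Reaches A val i a₀ j a → A.Moves val i j a b →
      Reaches A val i a₀ (j + 1) b

variable {ι : Type*} {A : BSPExecution p V} {val : V → ι} {i : ι} {a₀ : Fin p}

theorem Reaches.mono {j j' : ℕ} {a : Fin p} (h : A.Reaches val i a₀ j a) (hj : j ≤ j') :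
    A.Reaches val i a₀ j' a := by
  induction hj with
  | refl => exact h
  | step _ ih => exact ih.step (Or.inl rfl)

theorem Reaches.exists_trajectory {j : ℕ} {a : Fin p} (h : A.Reaches val i a₀ j a) :
    ∃ f : ℕ → Fin p, f 0 = a₀ ∧ f j = a ∧ ∀ j' < j, A.Moves val i j' (f j') (f (j' + 1)) := by
  induction h with
  | start => exact ⟨fun _ => a₀, rfl, rfl, by simp⟩
  | @step j a b _ hm ih =>
    obtain ⟨f, h0, hj, hf⟩ := ih
    refine ⟨fun t => if t ≤ j then f t else b, by simp [h0], by simp, fun j' hj' => ?_⟩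
    rcases Nat.lt_succ_iff_lt_or_eq.1 hj' with hlt | rfl
    · simpa [hlt.le, Nat.succ_le_of_lt hlt] using hf j' hlt
    · simpa [hj] using hm

/-- If a token reaches every processor that evaluates the node `u` it occupies, then it reaches
every processor that holds the value of `u`. -/
theorem Evaluates.reaches_of_mem_known {Arc : V → V → Prop} (hA : A.Evaluates Arc) {u : V}
    (hu : val u = i) (hev : ∀ j < A.steps, ∀ a, u ∈ A.evals j a → A.Reaches val i a₀ j a) :
    ∀ j ≤ A.steps, ∀ a, u ∈ A.known j a → A.Reaches val i a₀ j a := by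
  intro j
  induction j using Nat.strong_induction_on with
  | _ j ih =>
    rintro hj a ⟨j', hj', h | ⟨m, hm, rfl, hc⟩⟩
    · exact (hev j' (by omega) a h).mono hj'.le
    · have hsrc : A.Reaches val i a₀ j' m.src :=
        (hA.sends j' (by omega) m hm u hc).elim (ih j' hj' (by omega) m.src)
          (hev j' (by omega) m.src)
      exact (hsrc.step (Or.inr ⟨m, hm, rfl, rfl, u, hc, hu⟩)).mono hj'

end BSPExecution

theorem evaluatesAt_of_mem {p : ℕ} {V : Type*} {A : BSPExecution p V} {j : ℕ} {a : Fin p} {u : V}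
    (hj : j < A.steps) (h : u ∈ A.evals j a) : ∃ k, A.EvaluatesAt u j a k := by
  obtain ⟨k, hk⟩ := List.mem_iff_getElem?.1 h
  exact ⟨k, hj, hk⟩

/-- A token routed by switches reaches every processor that evaluates a node on its route. -/
theorem GateNetwork.IsRun.reaches {n p : ℕ} {K : Type*} [Finite K] {N : GateNetwork n K}
    {s : K → Bool} {val : Fin n ⊕ (K × Bool) → Fin n}
    (hval : N.IsRun (fun k => GateNetwork.switch (s k)) id val)
    {A : BSPExecution p (Fin n ⊕ (K × Bool))} (hA : A.Evaluates N.Arc)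
    {P : Fin n ⊕ (K × Bool) → Fin p} (hP : ∀ v j i k, A.EvaluatesAt v j i k → i = P v)
    (u : Fin n ⊕ (K × Bool)) (j : ℕ) (hj : j < A.steps) (a : Fin p) (h : u ∈ A.evals j a) :
    A.Reaches val (val u) (P (Sum.inl (val u))) j a := by
  have input : ∀ i : Fin n, ∀ j < A.steps, ∀ a, Sum.inl i ∈ A.evals j a →
      A.Reaches val (val (Sum.inl i)) (P (Sum.inl (val (Sum.inl i)))) j a := by
    intro i j hj a h
    obtain ⟨k, hk⟩ := evaluatesAt_of_mem hj h
    -- An input is evaluated nowhere but at `P`, so its token is at its starting point.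
    rw [hval.1 i, id, ← hP _ _ _ _ hk]
    exact BSPExecution.Reaches.start.mono (Nat.zero_le j)
  have gate : ∀ k b, ∀ j < A.steps, ∀ a, Sum.inr (k, b) ∈ A.evals j a →
      A.Reaches val (val (Sum.inr (k, b))) (P (Sum.inl (val (Sum.inr (k, b))))) j a := by
    intro k
    induction k using N.wellFounded_feeds.induction with
    | _ k ih =>
      intro b j hj a h
      obtain ⟨b', hb⟩ := exists_operand_eq (s k) b (fun b => val (N.operand k b))
      have hop : ∀ j < A.steps, ∀ a, N.operand k b' ∈ A.evals j a →
          A.Reaches val (val (N.operand k b')) (P (Sum.inl (val (N.operand k b')))) j a := by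
        rcases ho : N.operand k b' with i | ⟨k', b''⟩
        · exact input i
        · exact ih k' ⟨b'', b', ho⟩ b''
      obtain ⟨t, ht⟩ := evaluatesAt_of_mem hj h
      rw [(hval.2 k b).trans hb.symm]
      -- The token came through operand `b'`, which the processor held before this superstep or
      -- evaluated earlier within it.
      rcases hA.operands _ _ _ _ ht (N.operand k b') ⟨k, b, b', rfl, rfl⟩ with hu | hu
      · exact hA.reaches_of_mem_known rfl hop j hj.le a hu
      · exact hop j hj a (List.mem_of_mem_take hu)
  rcases u with i | ⟨k, b⟩
  · exact input i j hj a h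
  · exact gate k b j hj a h

/-! ### Counting the placements reachable by communication. -/

namespace BSPExecution

variable {p : ℕ} {V ι : Type*}

theorem countP_src_le_degree (A : BSPExecution p V) (j : ℕ) (a : Fin p) :
    (A.msgs j).countP (fun m => m.src = a) ≤ A.degree j :=
  (le_max_left _ _).trans (Finset.le_sup (f := fun i : Fin p =>
    max ((A.msgs j).countP fun m => m.src = i) ((A.msgs j).countP fun m => m.dst = i))
    (Finset.mem_univ a))

theorem countP_dst_le_degree (A : BSPExecution p V) (j : ℕ) (a : Fin p) :
    (A.msgs j).countP (fun m => m.dst = a) ≤ A.degree j :=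
  (le_max_right _ _).trans (Finset.le_sup (f := fun i : Fin p =>
    max ((A.msgs j).countP fun m => m.src = i) ((A.msgs j).countP fun m => m.dst = i))
    (Finset.mem_univ a))

theorem card_filter_toFinset_le_countP {α : Type*} [DecidableEq α] (s : Multiset α) (P : α → Prop)
    [DecidablePred P] : (s.toFinset.filter P).card ≤ s.countP P := by
  rw [Multiset.countP_eq_card_filter]
  exact Multiset.card_le_card (Multiset.filter_le_filter _ (Multiset.dedup_le s))

/-- All tokens move in superstep `j`, from the placement `g` to the placement `g'`. -/
def Step (A : BSPExecution p V) (j : ℕ) (g g' : ι → Fin p) : Prop :=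
  ∃ val : V → ι, ∀ i, A.Moves val i j (g i) (g' i)

open Classical in
/-- A step is determined by the choice, for each message, of a token at its source or none. -/
theorem card_step_le_prod [Fintype ι] (A : BSPExecution p V) (j : ℕ) (g : ι → Fin p) :
    (Finset.univ.filter (A.Step j g)).card ≤
      ∏ m ∈ (A.msgs j).toFinset, ((Finset.univ.filter fun i => g i = m.src).card + 1) := by
  -- Equal messages carry the same token, so one choice per distinct message suffices.
  set M := (A.msgs j).toFinset with hM
  let choices : Finset (M → Option ι) :=
    Fintype.piFinset fun m : M => (Finset.univ.filter fun i => g i = m.1.src).insertNone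
  let decode : (M → Option ι) → ι → Fin p := fun φ i =>
    if h : ∃ m : M, φ m = some i then h.choose.1.dst else g i
  have hsub : Finset.univ.filter (A.Step j g) ⊆ choices.image decode := by
    intro g' hg'
    obtain ⟨val, hval⟩ := (Finset.mem_filter.1 hg').2
    -- A message is credited with its token only if its endpoints agree with `g` and `g'`; whichever
    -- message `decode` picks then has destination `g' i`.
    let φ : M → Option ι := fun m => (m.1.content.map val).filter
      fun i => g i = m.1.src ∧ g' i = m.1.dst
    have hφ : ∀ m i, φ m = some i ↔
        (∃ u, m.1.content = some u ∧ val u = i) ∧ g i = m.1.src ∧ g' i = m.1.dst := by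
      intro m i
      simp [φ, Option.filter_eq_some_iff]
    refine Finset.mem_image.2 ⟨φ, ?_, ?_⟩
    · refine Fintype.mem_piFinset.2 fun m => Finset.mem_insertNone.2 fun i hi => ?_
      simpa using ((hφ m i).1 hi).2.1
    · funext i
      by_cases h : ∃ m : M, φ m = some i
      · simp only [decode, dif_pos h]
        exact ((hφ _ _).1 h.choose_spec).2.2.symm
      · simp only [decode, dif_neg h]
        rcases hval i with hi | ⟨m, hm, hs, hd, hu⟩
        · exact hi.symm
        · exact absurd ⟨⟨m, by simpa [hM] using hm⟩, (hφ _ _).2 ⟨hu, hs.symm, hd.symm⟩⟩ h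
  calc _ ≤ choices.card := (Finset.card_le_card hsub).trans Finset.card_image_le
    _ = _ := by
      simp only [choices, Fintype.card_piFinset, Finset.card_insertNone]
      exact Finset.prod_coe_sort M
        fun m => (Finset.univ.filter fun i => g i = m.src).card + 1

-- An AM-GM estimate: the factors sum to `n + p ≤ 2n = c * p` with `c = 2n/p`, and `x ≤ c * exp (x/c
-- - 1)` for each factor.
open Classical in
theorem prod_card_fiber_add_one_le [Fintype ι] (hp : 0 < p) (hpn : p ≤ Fintype.card ι)
    (g : ι → Fin p) :
    ∏ a : Fin p, (((Finset.univ.filter fun i => g i = a).card : ℝ) + 1) ≤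
      (2 * Fintype.card ι / p : ℝ) ^ p := by
  set n := Fintype.card ι with hn
  have hp' : (0 : ℝ) < p := by exact_mod_cast hp
  have hn' : (0 : ℝ) < n := by exact_mod_cast hp.trans_le hpn
  have hpn' : (p : ℝ) ≤ n := by exact_mod_cast hpn
  set c : ℝ := 2 * n / p with hc
  have hc0 : 0 < c := by positivity
  have hsum : ∑ a : Fin p, (((Finset.univ.filter fun i => g i = a).card : ℝ) + 1) = n + p := by
    rw [Finset.sum_add_distrib, ← Nat.cast_sum,
      ← Finset.card_eq_sum_card_fiberwise (fun _ _ => Finset.mem_coe.2 (Finset.mem_univ _))]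
    simp [hn]
  calc _ ≤ ∏ a : Fin p,
        c * Real.exp ((((Finset.univ.filter fun i => g i = a).card : ℝ) + 1) / c - 1) := by
        refine Finset.prod_le_prod (fun _ _ => by positivity) fun a _ => ?_
        have := Real.add_one_le_exp
          ((((Finset.univ.filter fun i => g i = a).card : ℝ) + 1) / c - 1)
        rw [sub_add_cancel, div_le_iff₀ hc0] at this
        linarith
    _ = c ^ p * Real.exp ((n + p) / c - p) := by
        rw [Finset.prod_mul_distrib, ← Real.exp_sum, Finset.sum_sub_distrib, ← Finset.sum_div, hsum]
        simp
    _ ≤ c ^ p := by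
        refine mul_le_of_le_one_right (by positivity) (Real.exp_le_one_iff.2 ?_)
        rw [sub_nonpos, div_le_iff₀ hc0, hc, mul_div_cancel₀ _ hp'.ne']
        linarith

open Classical in
theorem card_step_le [Fintype ι] (A : BSPExecution p V) (hp : 0 < p) (hpn : p ≤ Fintype.card ι)
    (j : ℕ) (g : ι → Fin p) :
    ((Finset.univ.filter (A.Step j g)).card : ℝ) ≤
      (2 * Fintype.card ι / p : ℝ) ^ (p * A.degree j) := by
  have h : (Finset.univ.filter (A.Step j g)).card ≤
      (∏ a : Fin p, ((Finset.univ.filter fun i => g i = a).card + 1)) ^ A.degree j := by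
    refine (A.card_step_le_prod j g).trans ?_
    rw [← Finset.prod_fiberwise_of_maps_to' (t := Finset.univ) (g := BSPMessage.src)
      (fun _ _ => Finset.mem_univ _)
      (fun a => (Finset.univ.filter fun i => g i = a).card + 1), ← Finset.prod_pow]
    refine Finset.prod_le_prod' fun a _ => ?_
    rw [Finset.prod_const]
    -- The choice "no token" keeps the base at least 1, so the number of messages from `a` may be
    -- raised to the degree.
    refine Nat.pow_le_pow_right (Nat.succ_pos _) ?_
    refine le_trans ?_ (A.countP_src_le_degree j a)
    convert card_filter_toFinset_le_countP (A.msgs j) (fun m => m.src = a)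
  calc _ ≤ ((∏ a : Fin p, (((Finset.univ.filter fun i => g i = a).card : ℝ) + 1)) ^ A.degree j) := by
        exact_mod_cast h
    _ ≤ _ := by
        rw [pow_mul]
        exact pow_le_pow_left₀ (by positivity) (prod_card_fiber_add_one_le hp hpn g) _

/-- The number of placements of tokens that can arise from a given one by the communication of the
first `J` supersteps. -/
theorem exists_card_placements_le [Fintype ι] (A : BSPExecution p V) (hp : 0 < p)
    (hpn : p ≤ Fintype.card ι) (g₀ : ι → Fin p) (J : ℕ) :
    ∃ W : Finset (ι → Fin p),
      (W.card : ℝ) ≤ (2 * Fintype.card ι / p : ℝ) ^ (p * ∑ j ∈ Finset.range J, A.degree j) ∧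
      ∀ F : ℕ → ι → Fin p, F 0 = g₀ → (∀ j < J, A.Step j (F j) (F (j + 1))) → F J ∈ W := by
  classical
  induction J with
  | zero => exact ⟨{g₀}, by simp, fun F hF _ => by simp [hF]⟩
  | succ J ih =>
    obtain ⟨W, hW, hF⟩ := ih
    refine ⟨W.biUnion fun g => Finset.univ.filter (A.Step J g), ?_, fun F h0 hstep => ?_⟩
    · calc _ ≤ ((∑ g ∈ W, (Finset.univ.filter (A.Step J g)).card : ℕ) : ℝ) := by
            exact_mod_cast Finset.card_biUnion_le
        _ ≤ W.card * (2 * Fintype.card ι / p : ℝ) ^ (p * A.degree J) := by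
            rw [Nat.cast_sum, ← nsmul_eq_mul]
            exact Finset.sum_le_card_nsmul _ _ _ fun g _ => A.card_step_le hp hpn J g
        _ ≤ _ := by
            rw [Finset.sum_range_succ, mul_add, pow_add]
            exact mul_le_mul_of_nonneg_right hW (by positivity)
    · exact Finset.mem_biUnion.2 ⟨F J, hF F h0 fun j hj => hstep j (by omega),
        Finset.mem_filter.2 ⟨Finset.mem_univ _, hstep J (by omega)⟩⟩

/-! ### Counting the tokens that cross the boundary of one processor. -/

/-- If every token of `S` moves along messages counted by `P` at least once, then `S` has at most
as many elements as there are such messages. -/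
theorem card_le_sum_countP (A : BSPExecution p V) (val : V → ι) (S : Finset ι)
    (P : BSPMessage p V → Prop) [DecidablePred P] (J : ℕ)
    (h : ∀ i ∈ S, ∃ j < J, ∃ m ∈ A.msgs j, P m ∧ ∃ u, m.content = some u ∧ val u = i) :
    S.card ≤ ∑ j ∈ Finset.range J, (A.msgs j).countP P := by
  classical
  -- A message carries at most one node, hence at most one token.
  have hsub : S.image some ⊆ (Finset.range J).biUnion fun j =>
      ((A.msgs j).toFinset.filter P).image fun m => m.content.map val := by
    intro x hx
    obtain ⟨i, hi, rfl⟩ := Finset.mem_image.1 hx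
    obtain ⟨j, hj, m, hm, hP, u, hu, hv⟩ := h i hi
    exact Finset.mem_biUnion.2 ⟨j, Finset.mem_range.2 hj, Finset.mem_image.2
      ⟨m, Finset.mem_filter.2 ⟨Multiset.mem_toFinset.2 hm, hP⟩, by simp [hu, hv]⟩⟩
  rw [← Finset.card_image_of_injective S (Option.some_injective ι)]
  refine (Finset.card_le_card hsub).trans (Finset.card_biUnion_le.trans ?_)
  exact Finset.sum_le_sum fun j _ =>
    Finset.card_image_le.trans (card_filter_toFinset_le_countP _ _)

theorem exists_lt_entering {f : ℕ → Fin p} {a : Fin p} {J : ℕ} (h0 : f 0 ≠ a) (hJ : f J = a) :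
    ∃ j < J, f j ≠ a ∧ f (j + 1) = a := by
  induction J with
  | zero => exact absurd hJ h0
  | succ J ih =>
    by_cases h : f J = a
    · obtain ⟨j, hj, hf⟩ := ih h
      exact ⟨j, by omega, hf⟩
    · exact ⟨J, by omega, h, hJ⟩

theorem exists_lt_leaving {f : ℕ → Fin p} {a : Fin p} {J : ℕ} (h0 : f 0 = a) (hJ : f J ≠ a) :
    ∃ j < J, f j = a ∧ f (j + 1) ≠ a := by
  induction J with
  | zero => exact absurd h0 hJ
  | succ J ih =>
    by_cases h : f J = a
    · exact ⟨J, by omega, h, hJ⟩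
    · obtain ⟨j, hj, hf⟩ := ih h
      exact ⟨j, by omega, hf⟩

/-- Tokens that enter processor `a` are at most as many as the communication complexity. -/
theorem card_entering_le (A : BSPExecution p V) (val : V → ι) (F : ℕ → ι → Fin p)
    (hF : ∀ i, ∀ j < A.steps, A.Moves val i j (F j i) (F (j + 1) i)) (a : Fin p) (S : Finset ι)
    (hS : ∀ i ∈ S, F 0 i ≠ a ∧ F A.steps i = a) : S.card ≤ A.commComplexity := by
  refine (A.card_le_sum_countP val S (fun m => m.dst = a) A.steps fun i hi => ?_).trans
    (Finset.sum_le_sum fun j _ => A.countP_dst_le_degree j a)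
  obtain ⟨j, hj, h1, h2⟩ := exists_lt_entering (f := fun j => F j i) (hS i hi).1 (hS i hi).2
  rcases hF i j hj with h | ⟨m, hm, -, hd, hu⟩
  · exact absurd (h.symm.trans h2) h1
  · exact ⟨j, hj, m, hm, hd.trans h2, hu⟩

/-- Tokens that leave processor `a` are at most as many as the communication complexity. -/
theorem card_leaving_le (A : BSPExecution p V) (val : V → ι) (F : ℕ → ι → Fin p)
    (hF : ∀ i, ∀ j < A.steps, A.Moves val i j (F j i) (F (j + 1) i)) (a : Fin p) (S : Finset ι)
    (hS : ∀ i ∈ S, F 0 i = a ∧ F A.steps i ≠ a) : S.card ≤ A.commComplexity := by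
  refine (A.card_le_sum_countP val S (fun m => m.src = a) A.steps fun i hi => ?_).trans
    (Finset.sum_le_sum fun j _ => A.countP_src_le_degree j a)
  obtain ⟨j, hj, h1, h2⟩ := exists_lt_leaving (f := fun j => F j i) (hS i hi).1 (hS i hi).2
  rcases hF i j hj with h | ⟨m, hm, hs, -, hu⟩
  · exact absurd (h.trans h1) h2
  · exact ⟨j, hj, m, hm, hs.trans h1, hu⟩

end BSPExecution

/-! ### The exchange bound and the counting bound for permutation networks. -/

/-- Each permutation of the inputs gives rise to trajectories of the tokens, from the processors
that evaluate the inputs to the processors that evaluate the outputs. -/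
theorem GateNetwork.IsPermuting.exists_trajectories {n p : ℕ} {K : Type*} [Finite K]
    {N : GateNetwork n K} (hN : N.IsPermuting) {A : BSPExecution p (Fin n ⊕ (K × Bool))}
    (hA : A.Evaluates N.Arc) {P : Fin n ⊕ (K × Bool) → Fin p}
    (hP : ∀ v j i k, A.EvaluatesAt v j i k → i = P v) (π : Equiv.Perm (Fin n)) :
    ∃ (val : Fin n ⊕ (K × Bool) → Fin n) (F : ℕ → Fin n → Fin p),
      (F 0 = fun i => P (Sum.inl i)) ∧ (F A.steps = fun i => P (N.out (π i))) ∧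
      ∀ i, ∀ j < A.steps, A.Moves val i j (F j i) (F (j + 1) i) := by
  obtain ⟨s, val, hval, hout⟩ := hN π
  have key : ∀ i, ∃ f : ℕ → Fin p, f 0 = P (Sum.inl i) ∧ f A.steps = P (N.out (π i)) ∧
      ∀ j < A.steps, A.Moves val i j (f j) (f (j + 1)) := by
    intro i
    obtain ⟨j, a, k, h⟩ := hA.all (N.out (π i))
    have hr := hval.reaches hA hP _ j h.1 a (List.mem_of_getElem? h.2)
    rw [hout i, hP _ _ _ _ h] at hr
    exact (hr.mono h.1.le).exists_trajectory
  choose f h0 hJ hf using key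
  exact ⟨val, fun j i => f i j, funext h0, funext hJ, hf⟩

/-- The outputs evaluated by processor `a` correspond to the network outputs placed there. -/
theorem GateNetwork.ncard_outputsOf {n p : ℕ} {K : Type*} (N : GateNetwork n K)
    {A : BSPExecution p (Fin n ⊕ (K × Bool))}
    (hA : A.Evaluates N.Arc) {P : Fin n ⊕ (K × Bool) → Fin p}
    (hP : ∀ v j i k, A.EvaluatesAt v j i k → i = P v) (a : Fin p) :
    (A.outputsOf N.Arc a).ncard = (Finset.univ.filter fun j => P (N.out j) = a).card := by
  have : A.outputsOf N.Arc a = N.out '' (Finset.univ.filter fun j => P (N.out j) = a : Finset _) := by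
    ext v
    simp only [BSPExecution.outputsOf, Set.mem_ofPred_eq, N.forall_not_arc_iff, Finset.coe_filter,
      Finset.mem_univ, true_and, Set.mem_image]
    constructor
    · rintro ⟨⟨t, rfl⟩, j, k, h⟩
      exact ⟨t, (hP _ _ _ _ h).symm, rfl⟩
    · rintro ⟨t, ht, rfl⟩
      obtain ⟨j, i, k, h⟩ := hA.all (N.out t)
      obtain rfl := (hP _ _ _ _ h).trans ht
      exact ⟨⟨t, rfl⟩, j, k, h⟩
  rw [this, Set.ncard_image_of_injective _ N.out_injective, Set.ncard_coe_finset]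

/-- Some permutation maps as many elements of `S` into `T` as cardinalities permit. -/
theorem exists_perm_card_filter_ge {α : Type*} [Fintype α] [DecidableEq α] (S T : Finset α) :
    ∃ π : Equiv.Perm α, min S.card T.card ≤ (S.filter fun i => π i ∈ T).card := by
  obtain ⟨S', hS, hSc⟩ := Finset.exists_subset_card_eq (min_le_left S.card T.card)
  obtain ⟨T', hT, hTc⟩ := Finset.exists_subset_card_eq (min_le_right S.card T.card)
  let e : {x // x ∈ S'} ≃ {x // x ∈ T'} := Finset.equivOfCardEq (hSc.trans hTc.symm)
  refine ⟨e.extendSubtype, hSc.symm.le.trans (Finset.card_le_card fun x hx => ?_)⟩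
  exact Finset.mem_filter.2 ⟨hS hx, hT (e.extendSubtype_mem x hx)⟩

/-- A processor with `r` outputs has to exchange `min r (n - r)` tokens with the others. -/
theorem GateNetwork.IsPermuting.min_le_commComplexity {n p : ℕ} {K : Type*} [Finite K]
    {N : GateNetwork n K} (hN : N.IsPermuting) {A : BSPExecution p (Fin n ⊕ (K × Bool))}
    (hA : A.Evaluates N.Arc) {P : Fin n ⊕ (K × Bool) → Fin p}
    (hP : ∀ v j i k, A.EvaluatesAt v j i k → i = P v) (a : Fin p) :
    min (Finset.univ.filter fun j => P (N.out j) = a).card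
      (n - (Finset.univ.filter fun j => P (N.out j) = a).card) ≤ A.commComplexity := by
  set X : Finset (Fin n) := Finset.univ.filter fun i => P (Sum.inl i) = a with hX
  set Y : Finset (Fin n) := Finset.univ.filter fun j => P (N.out j) = a with hY
  have hXc : Xᶜ.card = n - X.card := by rw [Finset.card_compl, Fintype.card_fin]
  have hYc : Yᶜ.card = n - Y.card := by rw [Finset.card_compl, Fintype.card_fin]
  have enter : min Xᶜ.card Y.card ≤ A.commComplexity := by
    obtain ⟨π, hπ⟩ := exists_perm_card_filter_ge Xᶜ Y
    obtain ⟨val, F, h0, hJ, hF⟩ := hN.exists_trajectories hA hP π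
    refine hπ.trans (A.card_entering_le val F hF a _ fun i hi => ?_)
    simpa [hX, hY, h0, hJ] using hi
  have leave : min X.card Yᶜ.card ≤ A.commComplexity := by
    obtain ⟨π, hπ⟩ := exists_perm_card_filter_ge X Yᶜ
    obtain ⟨val, F, h0, hJ, hF⟩ := hN.exists_trajectories hA hP π
    refine hπ.trans (A.card_leaving_le val F hF a _ fun i hi => ?_)
    simpa [hX, hY, h0, hJ] using hi
  -- If `X.card ≤ Y.card`, then `n - X.card ≥ n - Y.card` and `enter` suffices; otherwise `leave`
  -- does.
  omega

/-- Counting permutations by the placements of the tokens they lead to. -/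
theorem GateNetwork.IsPermuting.factorial_le {n p : ℕ} {K : Type*} [Finite K]
    {N : GateNetwork n K} (hN : N.IsPermuting) (hp : 0 < p) (hpn : p ≤ n)
    {A : BSPExecution p (Fin n ⊕ (K × Bool))}
    (hA : A.Evaluates N.Arc) {P : Fin n ⊕ (K × Bool) → Fin p}
    (hP : ∀ v j i k, A.EvaluatesAt v j i k → i = P v) {q : ℕ}
    (hq : ∀ a, (Finset.univ.filter fun j => P (N.out j) = a).card ≤ q) :
    (n.factorial : ℝ) ≤ q ^ n * (2 * n / p : ℝ) ^ (p * A.commComplexity) := by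
  classical
  obtain ⟨W, hW, hmem⟩ := A.exists_card_placements_le hp
    (hpn.trans_eq (Fintype.card_fin n).symm) (fun i => P (Sum.inl i)) A.steps
  rw [Fintype.card_fin] at hW
  have hcount : n.factorial ≤ q ^ n * W.card := by
    have := Finset.card_le_mul_card_image_of_maps_to
      (s := (Finset.univ : Finset (Equiv.Perm (Fin n))))
      (f := fun π i => P (N.out (π i))) (t := W) (fun π _ => ?_) (q ^ n) (fun e _ => ?_)
    · rwa [Finset.card_univ, Fintype.card_perm, Fintype.card_fin] at this
    · obtain ⟨val, F, h0, hJ, hF⟩ := hN.exists_trajectories hA hP π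
      rw [← hJ]
      exact hmem F h0 fun j hj => ⟨val, fun i => hF i j hj⟩
    -- Given the final placement `e`, each `π i` is one of the at most `q` outputs at processor `e
    -- i`.
    · calc _ ≤ (Fintype.piFinset fun i => Finset.univ.filter fun j => P (N.out j) = e i).card := by
            refine Finset.card_le_card_of_injOn (fun π : Equiv.Perm (Fin n) => (π : Fin n → Fin n))
              (fun π hπ => ?_) (fun _ _ _ _ h => Equiv.coe_fn_injective h)
            have hπ' := (Finset.mem_filter.1 hπ).2
            exact Finset.mem_coe.2 (Fintype.mem_piFinset.2 fun i => by simpa using congrFun hπ' i)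
        _ ≤ q ^ n := by
            rw [Fintype.card_piFinset]
            exact (Finset.prod_le_prod' fun i _ => hq (e i)).trans_eq (by simp)
  calc (n.factorial : ℝ) ≤ q ^ n * W.card := by exact_mod_cast hcount
    _ ≤ _ := mul_le_mul_of_nonneg_left hW (by positivity)

/-! ### Real estimates and the final combination. -/

/-- A single term of the exponential series gives `n^n / n! ≤ exp n`, the only form of Stirling
needed. -/
theorem mul_log_le_of_factorial_le {n q M : ℕ} {c : ℝ} (hn : 0 < n) (hq : 0 < q) (hc : 0 < c)
    (h : (n.factorial : ℝ) ≤ q ^ n * c ^ M) :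
    n * Real.log (n / (Real.exp 1 * q)) ≤ M * Real.log c := by
  have hn' : (0 : ℝ) < n := by exact_mod_cast hn
  have hq' : (0 : ℝ) < q := by exact_mod_cast hq
  have h1 := Real.pow_div_factorial_le_exp _ hn'.le n
  have hf : (0 : ℝ) < n.factorial := by exact_mod_cast n.factorial_pos
  rw [div_le_iff₀ hf] at h1
  have h2 : (n : ℝ) ^ n ≤ Real.exp n * (q ^ n * c ^ M) :=
    h1.trans (mul_le_mul_of_nonneg_left h (Real.exp_pos _).le)
  have h3 := Real.log_le_log (by positivity) h2
  rw [Real.log_mul (by positivity) (by positivity), Real.log_mul (by positivity) (by positivity),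
    Real.log_exp, Real.log_pow, Real.log_pow, Real.log_pow] at h3
  rw [Real.log_div hn'.ne' (by positivity), Real.log_mul (by positivity) hq'.ne', Real.log_exp]
  linarith

/-- If few outputs share a processor, the counting bound prevails, otherwise the exchange bound. -/
theorem div_lt_of_counting_of_exchange {n p q H : ℝ} (hp : 1 ≤ p)
    (hpn : p ≤ 2 * n / Real.exp 1) (hn0 : 0 < n) (hnp : n ≤ p * q)
    (hH : n * Real.log (n / (Real.exp 1 * q)) ≤ p * H * Real.log (2 * n / p)) (hqH : q ≤ H) :
    n * Real.log (n / Real.exp 1) / (8 * p * Real.log (2 * n / p)) < H := by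
  have he := Real.exp_pos 1
  have hp0 : 0 < p := by linarith
  have hq0 : 0 < q := by
    by_contra hq
    nlinarith
  have hx : Real.exp 1 ≤ 2 * n / p := by
    rw [le_div_iff₀ hp0]
    rw [le_div_iff₀ he] at hpn
    linarith
  have hL : 1 ≤ Real.log (2 * n / p) := by
    rwa [Real.le_log_iff_exp_le (by positivity)]
  set L := Real.log (2 * n / p) with hLdef
  have hL0 : 0 < L := by linarith
  rw [div_lt_iff₀ (by positivity)]
  set l := Real.log (n / Real.exp 1) with hl
  have hH0 : 0 < H := by linarith
  rcases le_or_gt l 0 with hl0 | hl0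
  · have : n * l ≤ 0 := mul_nonpos_of_nonneg_of_nonpos hn0.le hl0
    have : 0 < H * (8 * p * L) := by positivity
    linarith
  have hlog : Real.log (n / (Real.exp 1 * q)) = l - Real.log q := by
    rw [hl, ← Real.log_div (by positivity) hq0.ne', div_div]
  rw [hlog] at hH
  -- For `q ≤ exp (l/2)` counting wins: `l - log q ≥ l/2`.
  rcases le_or_gt (2 * Real.log q) l with hql | hql
  · nlinarith [mul_pos (mul_pos hp0 hH0) hL0]
  -- For `l < 8L` the exchange bound is enough: `n ≤ p * q ≤ p * H`.
  rcases lt_or_ge l (8 * L) with hlL | hlL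
  · have h1 : n * l < n * (8 * L) := by gcongr
    have h2 : n * (8 * L) ≤ p * H * (8 * L) := by
      refine mul_le_mul_of_nonneg_right (hnp.trans ?_) (by positivity)
      exact mul_le_mul_of_nonneg_left hqH hp0.le
    linarith
  -- Now `L ≤ l/8` and `q > exp (l/2)`, so `H ≥ q` exceeds `exp L * (l/8)`, that is, `n * l / (4 *
  -- p)`.
  have hexp : 2 * n / p = Real.exp L := (Real.exp_log (by positivity)).symm
  have hqe : Real.exp (l / 2) < q := by
    rw [← Real.lt_log_iff_exp_lt hq0]; linarith
  have h2n : 2 * n = Real.exp L * p := by rw [← hexp]; field_simp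
  have h3 : Real.exp L ≤ Real.exp (l / 8) := Real.exp_le_exp.2 (by linarith)
  have h4 : l / 8 ≤ Real.exp (l / 8) := by linarith [Real.add_one_le_exp (l / 8)]
  have h5 : Real.exp (l / 8) * Real.exp (l / 8) ≤ Real.exp (l / 2) := by
    rw [← Real.exp_add]; exact Real.exp_le_exp.2 (by linarith)
  have h6 : Real.exp L * (l / 8) < H := by
    have : Real.exp L * (l / 8) ≤ Real.exp (l / 8) * Real.exp (l / 8) :=
      mul_le_mul h3 h4 (by positivity) (Real.exp_pos _).le
    linarith
  have h7 : 2 * (n * l) < 8 * p * H := by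
    have : 2 * (n * l) = 8 * p * (Real.exp L * (l / 8)) := by
      linear_combination l * h2n
    rw [this]
    exact mul_lt_mul_of_pos_left h6 (by positivity)
  have h8 : 8 * p * H ≤ H * (8 * p * L) := by
    have : 0 < 8 * p * H := by positivity
    nlinarith
  have : 0 < n * l := by positivity
  linarith

theorem theorem4 {n p : ℕ} {K : Type*} [Fintype K] (N : GateNetwork n K)
    (hN : N.IsSorting ∨ N.IsPermuting)
    (hp : 1 ≤ p) (hpn : (p : ℝ) ≤ 2 * n / Real.exp 1)
    (A : BSPExecution p (Fin n ⊕ (K × Bool)))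
    (hA : A.Evaluates N.Arc) (hrec : A.WithoutRecomputation)
    (q : ℕ) (hq : q = A.maxOutputs N.Arc) :
    (n * Real.log (n / (4 * Real.exp 1 * q ^ 2)) / (4 * p * Real.log (2 * n / p))
        + min (q : ℝ) (n - q) / 4 ≤ (A.commComplexity : ℝ)) ∧
    ((q : ℝ) ≤ n / 2 →
      n * Real.log (n / Real.exp 1) / (8 * p * Real.log (2 * n / p))
        < (A.commComplexity : ℝ)) := by
  have hN : N.IsPermuting := hN.elim GateNetwork.IsSorting.isPermuting id
  obtain ⟨P, hP⟩ : ∃ P : Fin n ⊕ (K × Bool) → Fin p,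
      ∀ v j i k, A.EvaluatesAt v j i k → i = P v := by
    choose t _ ht using hrec
    exact ⟨fun v => (t v).2.1, fun v j i k h => congrArg (fun t => t.2.1) (ht v (j, i, k) h)⟩
  set D : Fin p → ℕ := fun a => (Finset.univ.filter fun j => P (N.out j) = a).card with hD
  have hqD : q = Finset.univ.sup D := by
    rw [hq, BSPExecution.maxOutputs]
    exact Finset.sup_congr rfl fun a _ => N.ncard_outputsOf hA hP a
  have hDq : ∀ a, D a ≤ q := fun a => hqD ▸ Finset.le_sup (Finset.mem_univ a)
  obtain ⟨a, ha⟩ : ∃ a, D a = q := by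
    obtain ⟨a, -, ha⟩ := Finset.exists_mem_eq_sup Finset.univ ⟨⟨0, hp⟩, Finset.mem_univ _⟩ D
    exact ⟨a, by rw [hqD, ha]⟩
  have hsum : n ≤ p * q := by
    have h1 : n = ∑ a, D a := by
      simpa using Finset.card_eq_sum_card_fiberwise (s := (Finset.univ : Finset (Fin n)))
        (t := Finset.univ) (f := fun j => P (N.out j)) (fun _ _ => by simp)
    rw [h1]
    exact (Finset.sum_le_sum fun a _ => hDq a).trans_eq (by simp)
  have hqn : q ≤ n := by
    rw [← ha]
    exact (Finset.card_le_univ _).trans_eq (Fintype.card_fin n)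
  have hmin : min q (n - q) ≤ A.commComplexity := by
    have := hN.min_le_commComplexity hA hP a
    rwa [show (Finset.univ.filter fun j => P (N.out j) = a).card = q from ha] at this
  have he := Real.exp_pos 1
  -- As `e > 2`, the hypothesis on `p` gives `p ≤ n`, which the AM-GM estimate requires.
  have he2 : 2 < Real.exp 1 := by linarith [Real.exp_one_gt_d9]
  have hpn_mul : (p : ℝ) * Real.exp 1 ≤ 2 * n := (le_div_iff₀ he).1 hpn
  have hp1 : (1 : ℝ) ≤ p := by exact_mod_cast hp
  have hpn' : p ≤ n := by
    have : (p : ℝ) ≤ n := by nlinarith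
    exact_mod_cast this
  have hn2 : 2 ≤ n := by
    have : (1 : ℝ) < n := by nlinarith
    exact_mod_cast this
  have hq1 : 1 ≤ q := by
    rcases Nat.eq_zero_or_pos q with rfl | h
    · omega
    · exact h
  have hn0 : (0 : ℝ) < n := by exact_mod_cast (by omega : 0 < n)
  have hq1' : (1 : ℝ) ≤ q := by exact_mod_cast hq1
  have hx : Real.exp 1 ≤ 2 * n / p := by
    rw [le_div_iff₀ (by linarith)]; linarith
  have hL : 1 ≤ Real.log (2 * n / p) := by
    rwa [Real.le_log_iff_exp_le (by positivity)]
  have hcount := mul_log_le_of_factorial_le (by omega) hq1 (by positivity : (0 : ℝ) < 2 * n / p)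
    (hN.factorial_le hp hpn' hA hP hDq)
  push_cast at hcount
  have hminR : min (q : ℝ) (n - q) ≤ A.commComplexity := by
    rw [← Nat.cast_sub hqn]
    exact_mod_cast hmin
  constructor
  -- Each summand is at most a quarter of the communication. Comparing logarithms by monotonicity
  -- also covers negative values.
  · have hlog : Real.log (n / (4 * Real.exp 1 * q ^ 2)) ≤ Real.log (n / (Real.exp 1 * q)) := by
      refine Real.log_le_log (by positivity) ?_
      refine div_le_div_of_nonneg_left hn0.le (by positivity) ?_
      nlinarith [mul_le_mul_of_nonneg_left hq1' (by positivity : (0 : ℝ) ≤ Real.exp 1 * q),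
        mul_pos he (by linarith : (0 : ℝ) < q)]
    have hterm : n * Real.log (n / (4 * Real.exp 1 * q ^ 2)) / (4 * p * Real.log (2 * n / p)) ≤
        A.commComplexity / 4 := by
      rw [div_le_iff₀ (by positivity)]
      calc _ ≤ _ := mul_le_mul_of_nonneg_left hlog hn0.le
        _ ≤ _ := hcount
        _ = _ := by ring
    have : (0 : ℝ) ≤ A.commComplexity := Nat.cast_nonneg _
    linarith
  · intro hqn2
    refine div_lt_of_counting_of_exchange hp1 hpn hn0 (by exact_mod_cast hsum)
      hcount ?_
    rwa [min_eq_left (by linarith)] at hminR
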